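/- There are absolute constants $c, C > 0$ such that the following holds. Let $\mathcal{Z}$ be a measurable space, $\mathcal{O}$ a finite set, $n \ge 0$ an integer, and let $A : \mathcal{Z}^n \to \mathcal{O}$ be a randomized algorithm (for each dataset $x \in \mathcal{Z}^n$, $A(x)$ is a probability distribution on $\mathcal{O}$ depending measurably on $x$). Let $\varepsilon, \delta, \beta \in (0, c]$ with $\varepsilon\sqrt{n\log(1/(\beta\delta))} \le c$. Suppose that $A$ is $(\varepsilon,\delta)$-item-level DP, i.e. $\Pr[A(x) \in S] \le e^{\varepsilon}\Pr[A(x') \in S] + \delta$ for all $S \subseteq \mathcal{O}$ and all $x, x' \in \mathcal{Z}^n$ that agree in all coordinates but at most one. Put $$\varepsilon' = C\,\varepsilon\sqrt{n\log(1/(\beta\delta))}, \qquad \delta' = C\,n\,\delta .$$ Then $A$ is $(\beta, \varepsilon', \delta')$-perfectly generalizing: for every probability distribution $D$ on $\mathcal{Z}$ there is a probability distribution $\mathrm{Sim}_D$ on $\mathcal{O}$ with $$\Pr_{x \sim D^n}\left[A(x) \approx_{\varepsilon',\delta'} \mathrm{Sim}_D\right] \ge 1 - \beta .$$ Here, for distributions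 $P, Q$ on $\mathcal{O}$, $P \approx_{\varepsilon',\delta'} Q$ means that $\sum_{o} \max(0, P(o) - e^{\varepsilon'}Q(o)) \le \delta'$ and $\sum_{o} \max(0, Q(o) - e^{\varepsilon'}P(o)) \le \delta'$. Furthermore, this holds for every $D$ with $\mathrm{Sim}_D$ chosen to be the distribution of $A(x)$ for a fresh dataset $x \sim D^n$. -/

import Mathlib

open MeasureTheory ProbabilityTheory

/-- The `e^ε`-hockey stick divergence of two distributions on a finite set,
`∑_o [P(o) - e^ε Q(o)]₊`. Points outside the support of `P` contribute `0`, so summing over all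
points is the same as summing over the support of `P`. -/
noncomputable def hockeyStick {O : Type*} [Fintype O] [MeasurableSpace O]
    (ε : ℝ) (P Q : Measure O) : ℝ :=
  ∑ o : O, max 0 (P.real {o} - Real.exp ε * Q.real {o})

/-- `P ≈_{ε,δ} Q`: both hockey stick divergences are at most `δ`. -/
def Indist {O : Type*} [Fintype O] [MeasurableSpace O]
    (ε δ : ℝ) (P Q : Measure O) : Prop :=
  hockeyStick ε P Q ≤ δ ∧ hockeyStick ε Q P ≤ δ

/-- Two datasets of `n` items are item-level neighbors if they agree after the removal of the
item at one position. -/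
def ItemNeighbors {Z : Type*} {n : ℕ} (x x' : Fin n → Z) : Prop :=
  ∃ i : Fin n, ∀ j : Fin n, j ≠ i → x j = x' j

/-- A randomized algorithm `A : Zⁿ → O` is a Markov kernel: `A x` is the distribution of its
output on the dataset `x`. It is `(ε, δ)`-item-level differentially private if
`Pr[A(x) ∈ S] ≤ e^ε Pr[A(x') ∈ S] + δ` for all neighbors `x, x'` and all `S ⊆ O`. -/
def IsItemLevelDP {Z O : Type*} [MeasurableSpace Z] [MeasurableSpace O] {n : ℕ}
    (A : Kernel (Fin n → Z) O) (ε δ : ℝ) : Prop :=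
  ∀ x x' : Fin n → Z, ItemNeighbors x x' → ∀ S : Set O,
    (A x).real S ≤ Real.exp ε * (A x').real S + δ

/-- `Pr_{x ∼ Dⁿ}[A(x) ≈_{ε,δ} Sim] ≥ 1 - β`. -/
def IsSimulatedBy {Z O : Type*} [MeasurableSpace Z] [Fintype O] [MeasurableSpace O] {n : ℕ}
    (A : Kernel (Fin n → Z) O) (β ε δ : ℝ) (D : Measure Z) (Sim : Measure O) : Prop :=
  1 - β ≤ (Measure.pi fun _ : Fin n => D).real {x | Indist ε δ (A x) Sim}

/-- `A` is `(β, ε, δ)`-perfectly generalizing: every data distribution `D` has a simulating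
distribution. -/
def IsPerfectlyGeneralizing {Z O : Type*} [MeasurableSpace Z] [Fintype O] [MeasurableSpace O]
    {n : ℕ} (A : Kernel (Fin n → Z) O) (β ε δ : ℝ) : Prop :=
  ∀ D : Measure Z, IsProbabilityMeasure D →
    ∃ Sim : Measure O, IsProbabilityMeasure Sim ∧ IsSimulatedBy A β ε δ D Sim

/-- The distribution of `A(x)` when `x ∼ Dⁿ` is a fresh dataset. -/
noncomputable def freshOutput {Z O : Type*} [MeasurableSpace Z] [MeasurableSpace O] {n : ℕ}
    (A : Kernel (Fin n → Z) O) (D : Measure Z) : Measure O :=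
  (Measure.pi fun _ : Fin n => D).bind A

/-! Average the items of the dataset out one at a time. By item-level DP, each step of the resulting
Doob martingale changes the probability of an output `o` by a factor in `[e^{-ε}, e^ε]`, apart from
excesses whose sum over `o` is at most `δ`. Hence the expectation of a convex 1-Lipschitz test
function is at most its value under the two-point martingale with jumps `e^{±ε}`, up to `4δ` per
item (`sum_integral_convex_le`). Put `L = log(1/(βδ))` and `τ = ε√(nL)`. For the test functions `(m
- T)₊` and `(T - m)₊`, Chernoff bounds by powers of `m` show that `A(x)` and its mean have expected
divergence `O(nδ)` at parameter `3τ` (`integral_hockeyStickSum_mean_le`).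

Markov's inequality alone would lose a factor `1/β` in `δ'`, so it is used only to get closeness
with probability `1/2`. Changing one item costs `ε` in the parameter, and a factor `e^ε` plus `O(δ)`
in the divergence. The least number of such degradations at which closeness holds is therefore a
function with bounded differences. By McDiarmid it stays below `2√(nL)` outside probability `2e^{-L}
= 2βδ ≤ β`, and that many degradations cost only `2τ` (`measureReal_not_indist_mean_le`). -/

/-! ### The two-point martingale and its tails -/

/-- The expectation of `g` under the two-point martingale step `m ↦ e^{±ε} m`. -/
noncomputable def binomialStep (ε : ℝ) (g : ℝ → ℝ) (m : ℝ) : ℝ :=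
  (g (Real.exp ε * m) + Real.exp ε * g (Real.exp (-ε) * m)) / (1 + Real.exp ε)

theorem binomialStep_convexOn {ε : ℝ} {g : ℝ → ℝ} (hg : ConvexOn ℝ Set.univ g) :
    ConvexOn ℝ Set.univ (binomialStep ε g) := by
  refine ⟨convex_univ, fun x _ y _ a b ha hb hab => ?_⟩
  have h (k : ℝ) := hg.2 (Set.mem_univ (k * x)) (Set.mem_univ (k * y)) ha hb hab
  have h1 := h (Real.exp ε)
  have h2 := mul_le_mul_of_nonneg_left (h (Real.exp (-ε))) (Real.exp_pos ε).le
  simp only [smul_eq_mul, binomialStep] at *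
  rw [show Real.exp ε * (a * x + b * y) = a * (Real.exp ε * x) + b * (Real.exp ε * y) by ring,
    show Real.exp (-ε) * (a * x + b * y)
      = a * (Real.exp (-ε) * x) + b * (Real.exp (-ε) * y) by ring,
    ← mul_div_assoc, ← mul_div_assoc, ← add_div]
  refine div_le_div_of_nonneg_right ?_ (by positivity)
  linarith

/-- The random factor `e^{±ε}` is positive with mean `1`, so averaging does not increase the
Lipschitz constant. -/
theorem binomialStep_sub_le {ε : ℝ} {g : ℝ → ℝ} (hg : ∀ x y, g x - g y ≤ |x - y|) (x y : ℝ) :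
    binomialStep ε g x - binomialStep ε g y ≤ |x - y| := by
  have h (k : ℝ) (hk : 0 < k) : g (k * x) - g (k * y) ≤ k * |x - y| := by
    have := hg (k * x) (k * y)
    rwa [← mul_sub, abs_mul, abs_of_pos hk] at this
  have h1 := h _ (Real.exp_pos ε)
  have h2 := mul_le_mul_of_nonneg_left (h _ (Real.exp_pos (-ε))) (Real.exp_pos ε).le
  have h3 : Real.exp ε * (Real.exp (-ε) * |x - y|) = |x - y| := by
    rw [← mul_assoc, ← Real.exp_add]; simp
  rw [h3] at h2
  unfold binomialStep
  rw [← sub_div, div_le_iff₀ (by positivity)]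
  linarith

theorem binomialStep_zero (ε : ℝ) (g : ℝ → ℝ) : binomialStep ε g 0 = g 0 := by
  have : (1 + Real.exp ε) ≠ 0 := by positivity
  unfold binomialStep
  simp only [mul_zero]
  field_simp

theorem binomialStep_iterate_zero (ε : ℝ) (g : ℝ → ℝ) (n : ℕ) :
    (binomialStep ε)^[n] g 0 = g 0 := by
  induction n generalizing g with
  | zero => rfl
  | succ n ih => rw [Function.iterate_succ_apply, ih, binomialStep_zero]

/-- The two-point law has mean `m`, so the chord of `g` over `[e^{-ε}m, e^ε m]` has height
`binomialStep ε g m` at `m`. Convexity puts `g` below the chord inside the interval. Outside, `g`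
and the chord are both 1-Lipschitz, so they separate at rate at most `2`. -/
theorem exists_slope_le_binomialStep {ε m : ℝ} (hε : 0 < ε) (hm : 0 ≤ m) {g : ℝ → ℝ}
    (hg : ConvexOn ℝ Set.univ g) (hL : ∀ x y, g x - g y ≤ |x - y|) :
    ∃ q : ℝ, ∀ y, g y ≤ binomialStep ε g m + q * (y - m) +
      2 * max 0 (y - Real.exp ε * m) + 2 * max 0 (Real.exp (-ε) * m - y) := by
  rcases hm.eq_or_lt with rfl | hm
  -- At `m = 0` the interval is a point and has no chord; the Lipschitz bound suffices with slope
  -- `0`.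
  · refine ⟨0, fun y => ?_⟩
    have h1 := hL y 0
    have h2 : |y - 0| ≤ max 0 y + max 0 (-y) := by
      rcases abs_cases (y - 0) with h | h <;> simp only [sub_zero] at h ⊢ <;>
        linarith [le_max_left 0 y, le_max_right 0 y, le_max_left 0 (-y), le_max_right 0 (-y)]
    rw [binomialStep_zero]
    simp only [mul_zero, sub_zero, zero_sub, zero_mul]
    linarith [le_max_left 0 y, le_max_left 0 (-y)]
  have hEE : Real.exp ε * Real.exp (-ε) = 1 := by rw [← Real.exp_add]; simp
  have hE1 : 1 < Real.exp ε := Real.one_lt_exp_iff.2 hε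
  have hE2 : Real.exp (-ε) < 1 := by rw [Real.exp_lt_one_iff]; linarith
  set E := Real.exp ε with hE
  set F := Real.exp (-ε) with hF
  set u := F * m with hu
  set v := E * m with hv
  have huv : u < v := by rw [hu, hv]; nlinarith
  set q := (g v - g u) / (v - u) with hq
  have hq' : q * (v - u) = g v - g u := div_mul_cancel₀ _ (by linarith)
  have hq1 : q ≤ 1 := by
    rw [hq, div_le_one (by linarith)]
    simpa [abs_of_pos (sub_pos.2 huv)] using hL v u
  have hq2 : -1 ≤ q := by
    rw [hq, le_div_iff₀ (by linarith)]
    have := hL u v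
    rw [abs_sub_comm, abs_of_pos (sub_pos.2 huv)] at this
    linarith
  have hline : binomialStep ε g m = g u + q * (m - u) := by
    have h1 : v - m = E * (m - u) := by
      rw [hv, hu]; linear_combination m * hEE
    have h2 : (1 + E) * (m - u) = v - u := by linarith
    unfold binomialStep
    rw [← hE, ← hF, ← hu, ← hv, div_eq_iff (by linarith)]
    linear_combination -hq' - q * h2
  refine ⟨q, fun y => ?_⟩
  rw [hline]
  have p1 := le_max_left 0 (y - v)
  have p2 := le_max_right 0 (y - v)
  have p3 := le_max_left 0 (u - y)
  have p4 := le_max_right 0 (u - y)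
  rcases lt_or_ge y u with h | h
  · have := hL y u
    rw [abs_sub_comm, abs_of_pos (sub_pos.2 h)] at this
    nlinarith
  rcases lt_or_ge v y with h' | h'
  · have := hL y v
    rw [abs_of_pos (sub_pos.2 h')] at this
    nlinarith
  · have h3 : 0 < v - u := sub_pos.2 huv
    have h5 := hg.2 (Set.mem_univ u) (Set.mem_univ v)
      (div_nonneg (sub_nonneg.2 h') h3.le) (div_nonneg (sub_nonneg.2 h) h3.le)
      (by field_simp; ring)
    simp only [smul_eq_mul] at h5
    have h6 : (v - y) / (v - u) * u + (y - u) / (v - u) * v = y := by field_simp; ring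
    have h7 : (v - y) / (v - u) * g u + (y - u) / (v - u) * g v = g u + q * (y - u) := by
      rw [hq]; field_simp; ring
    rw [h6, h7] at h5
    linarith

/-- On powers of `m` the binomial step acts as multiplication by a factor at most
`exp ((s - 1/2)² ε² / 2)`. -/
theorem binomialStep_le_rpow {ε s K : ℝ} (hK : 0 ≤ K) {g : ℝ → ℝ}
    (hg : ∀ m, 0 < m → g m ≤ K * m ^ s) {m : ℝ} (hm : 0 < m) :
    binomialStep ε g m ≤ K * Real.exp ((s - 1 / 2) ^ 2 * ε ^ 2 / 2) * m ^ s := by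
  have h1 := hg _ (mul_pos (Real.exp_pos ε) hm)
  have h2 := hg _ (mul_pos (Real.exp_pos (-ε)) hm)
  rw [Real.mul_rpow (Real.exp_pos _).le hm.le, ← Real.exp_mul] at h1 h2
  have hms : 0 ≤ m ^ s := (Real.rpow_pos_of_pos hm s).le
  have hE := Real.exp_pos ε
  set r := Real.exp ((s - 1 / 2) ^ 2 * ε ^ 2 / 2) with hr
  have hcosh : Real.exp (ε * s) + Real.exp ε * Real.exp (-ε * s)
      ≤ r * (1 + Real.exp ε) := by
    have c1 := Real.cosh_le_exp_half_sq ((s - 1 / 2) * ε)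
    have c2 := Real.one_le_cosh (ε / 2)
    -- The factor is exactly `cosh((s - 1/2)ε) / cosh(ε/2)`; the denominator is at least `1` and is
    -- discarded.
    have e1 : Real.exp (ε * s) + Real.exp ε * Real.exp (-ε * s)
        = 2 * Real.exp (ε / 2) * Real.cosh ((s - 1 / 2) * ε) := by
      rw [Real.cosh_eq, ← Real.exp_add]
      rw [show 2 * Real.exp (ε / 2) *
        ((Real.exp ((s - 1 / 2) * ε) + Real.exp (-((s - 1 / 2) * ε))) / 2)
        = Real.exp (ε / 2) * Real.exp ((s - 1 / 2) * ε)
          + Real.exp (ε / 2) * Real.exp (-((s - 1 / 2) * ε)) by ring, ← Real.exp_add,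
          ← Real.exp_add]
      congr 2 <;> ring
    have e2 : 1 + Real.exp ε = 2 * Real.exp (ε / 2) * Real.cosh (ε / 2) := by
      rw [Real.cosh_eq]
      rw [show 2 * Real.exp (ε / 2) * ((Real.exp (ε / 2) + Real.exp (-(ε / 2))) / 2)
        = Real.exp (ε / 2) * Real.exp (-(ε / 2)) + Real.exp (ε / 2) * Real.exp (ε / 2) by ring,
        ← Real.exp_add, ← Real.exp_add]
      simp
    have c3 : Real.cosh ((s - 1 / 2) * ε) ≤ r := by
      rw [hr]; convert c1 using 2; ring
    have hr0 : 0 < r := Real.exp_pos _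
    rw [e1, e2]
    have : Real.cosh ((s - 1 / 2) * ε) ≤ r * Real.cosh (ε / 2) := by nlinarith
    have := mul_le_mul_of_nonneg_left this (by positivity : 0 ≤ 2 * Real.exp (ε / 2))
    linarith
  unfold binomialStep
  rw [div_le_iff₀ (by positivity)]
  have h3 := mul_le_mul_of_nonneg_left h2 hE.le
  have h4 := mul_le_mul_of_nonneg_left hcosh (mul_nonneg hK hms)
  linarith

theorem binomialStep_iterate_le_rpow {ε s K : ℝ} (hK : 0 ≤ K) {g : ℝ → ℝ}
    (hg : ∀ m, 0 < m → g m ≤ K * m ^ s) (n : ℕ) {m : ℝ} (hm : 0 < m) :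
    (binomialStep ε)^[n] g m ≤ K * Real.exp (n * ((s - 1 / 2) ^ 2 * ε ^ 2 / 2)) * m ^ s := by
  induction n generalizing g K with
  | zero => simpa using hg m hm
  | succ n ih =>
    rw [Function.iterate_succ_apply]
    refine (ih (K := K * Real.exp ((s - 1 / 2) ^ 2 * ε ^ 2 / 2)) (by positivity)
      fun x hx => binomialStep_le_rpow hK hg hx).trans (le_of_eq ?_)
    rw [mul_assoc K, ← Real.exp_add]
    push_cast
    ring_nf

/-- Chernoff bound: with `T = e^t m₀`, `(m - T)₊ ≤ T^{-lam} m^{1+lam}`, and the power `s = 1 + lam`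
is multiplied by a controlled factor at each step. -/
theorem binomialStep_iterate_call_le {ε t lam m₀ : ℝ} (hlam : 0 ≤ lam) (hm₀ : 0 ≤ m₀) (n : ℕ) :
    (binomialStep ε)^[n] (fun m => max 0 (m - Real.exp t * m₀)) m₀ ≤
      Real.exp (-(lam * t) + n * ((lam + 1 / 2) ^ 2 * ε ^ 2 / 2)) * m₀ := by
  rcases hm₀.eq_or_lt with rfl | hm₀
  · simp [binomialStep_iterate_zero]
  have hT : 0 < Real.exp t * m₀ := by positivity
  refine (binomialStep_iterate_le_rpow (s := 1 + lam) (K := (Real.exp t * m₀) ^ (-lam))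
    (by positivity) (fun m hm => ?_) n hm₀).trans (le_of_eq ?_)
  · rw [Real.rpow_add hm, Real.rpow_one, Real.rpow_neg hT.le]
    have hp := Real.rpow_pos_of_pos hT lam
    have hp' := Real.rpow_pos_of_pos hm lam
    refine max_le (by positivity) ?_
    rcases le_or_gt m (Real.exp t * m₀) with h | h
    · exact (sub_nonpos.2 h).trans (by positivity)
    · have := Real.rpow_le_rpow hT.le h.le hlam
      rw [inv_mul_eq_div, le_div_iff₀ hp]
      nlinarith
  · rw [Real.mul_rpow (Real.exp_pos _).le hm₀.le, ← Real.exp_mul, Real.rpow_add hm₀,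
      Real.rpow_one, Real.rpow_neg hm₀.le, Real.exp_add]
    have hp := (Real.rpow_pos_of_pos hm₀ lam).ne'
    field_simp
    ring_nf

/-- Here `(T - m)₊ ≤ T (T/m)^lam` with `T = e^{-t} m₀`. The power `s = -lam` is the reflection of `1
+ lam` about `1/2`, so the growth factor is the same as for the upper tail. -/
theorem binomialStep_iterate_put_le {ε t lam m₀ : ℝ} (ht : 0 ≤ t) (hlam : 0 ≤ lam)
    (hm₀ : 0 ≤ m₀) (n : ℕ) :
    (binomialStep ε)^[n] (fun m => max 0 (Real.exp (-t) * m₀ - m)) m₀ ≤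
      Real.exp (-(lam * t) + n * ((lam + 1 / 2) ^ 2 * ε ^ 2 / 2)) * m₀ := by
  rcases hm₀.eq_or_lt with rfl | hm₀
  · simp [binomialStep_iterate_zero]
  have hT : 0 < Real.exp (-t) * m₀ := by positivity
  refine (binomialStep_iterate_le_rpow (s := -lam)
    (K := (Real.exp (-t) * m₀) * (Real.exp (-t) * m₀) ^ lam)
    (by positivity) (fun m hm => ?_) n hm₀).trans ?_
  · rw [Real.rpow_neg hm.le]
    have hp := Real.rpow_pos_of_pos hT lam
    have hp' := Real.rpow_pos_of_pos hm lam
    refine max_le (by positivity) ?_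
    rcases le_or_gt (Real.exp (-t) * m₀) m with h | h
    · exact (sub_nonpos.2 h).trans (by positivity)
    · have := Real.rpow_le_rpow hm.le h.le hlam
      rw [← div_eq_mul_inv, le_div_iff₀ hp']
      nlinarith
  · rw [Real.mul_rpow (Real.exp_pos _).le hm₀.le, ← Real.exp_mul, Real.rpow_neg hm₀.le,
      Real.exp_add]
    have hp := (Real.rpow_pos_of_pos hm₀ lam).ne'
    have h1 : Real.exp (-t) ≤ 1 := Real.exp_le_one_iff.2 (by linarith)
    have h2 : (-lam - 1 / 2) ^ 2 = (lam + 1 / 2) ^ 2 := by ring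
    rw [h2, show -t * lam = -(lam * t) by ring]
    set X := Real.exp (-(lam * t))
    set Y := Real.exp (n * ((lam + 1 / 2) ^ 2 * ε ^ 2 / 2))
    have : Real.exp (-t) * m₀ * (X * m₀ ^ lam) * Y * (m₀ ^ lam)⁻¹
        = Real.exp (-t) * (X * Y * m₀) := by field_simp
    rw [this]
    exact mul_le_of_le_one_left (by positivity) h1

/-! ### Integration over one item, and neighboring datasets -/

theorem integrable_of_measurable_of_abs_le {α : Type*} [MeasurableSpace α] {μ : Measure α}
    [IsFiniteMeasure μ] {f : α → ℝ} (hf : Measurable f) {b : ℝ} (hb : ∀ x, |f x| ≤ b) :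
    Integrable f μ :=
  Integrable.of_bound hf.aestronglyMeasurable b (Filter.Eventually.of_forall hb)

theorem abs_integral_le_of_abs_le {α : Type*} [MeasurableSpace α] {μ : Measure α}
    [IsProbabilityMeasure μ] {f : α → ℝ} {b : ℝ} (hb : ∀ x, |f x| ≤ b) :
    |∫ x, f x ∂μ| ≤ b := by
  simpa using norm_integral_le_of_norm_le_const (μ := μ) (f := f) (C := b)
    (Filter.Eventually.of_forall hb)

theorem measurable_finCons {Z : Type*} [MeasurableSpace Z] {n : ℕ} :
    Measurable fun p : (Fin n → Z) × Z => (Fin.cons p.2 p.1 : Fin (n + 1) → Z) := by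
  refine measurable_pi_iff.2 fun i => ?_
  refine Fin.cases ?_ (fun j => ?_) i
  · simpa using measurable_snd
  · simpa [Function.comp_def] using (measurable_pi_apply j).comp measurable_fst

theorem measurable_integral_finCons {Z : Type*} [MeasurableSpace Z] {n : ℕ} (D : Measure Z)
    [IsProbabilityMeasure D] {f : (Fin (n + 1) → Z) → ℝ} (hf : Measurable f) :
    Measurable fun y : Fin n → Z => ∫ z, f (Fin.cons z y) ∂D :=
  (StronglyMeasurable.integral_prod_right (ν := D)
    (f := fun (y : Fin n → Z) (z : Z) => f (Fin.cons z y))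
    (hf.comp measurable_finCons).stronglyMeasurable).measurable

theorem integral_pi_fin_zero {Z : Type*} [MeasurableSpace Z] (D : Measure Z)
    [IsProbabilityMeasure D] (f : (Fin 0 → Z) → ℝ) :
    ∫ x, f x ∂(Measure.pi fun _ : Fin 0 => D) = f default := by
  rw [show f = fun _ => f default from funext fun x => congrArg f (Subsingleton.elim _ _)]
  simp

theorem integral_pi_finCons {Z : Type*} [MeasurableSpace Z] {n : ℕ} (D : Measure Z)
    [IsProbabilityMeasure D] {f : (Fin (n + 1) → Z) → ℝ} (hf : Measurable f) {b : ℝ}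
    (hb : ∀ x, |f x| ≤ b) :
    ∫ x, f x ∂(Measure.pi fun _ : Fin (n + 1) => D) =
      ∫ y, ∫ z, f (Fin.cons z y) ∂D ∂(Measure.pi fun _ : Fin n => D) := by
  rw [← ((measurePreserving_piFinSuccAbove (fun _ : Fin (n + 1) => D) 0).symm).integral_comp']
  simp_rw [MeasurableEquiv.piFinSuccAbove_symm_apply, Fin.insertNthEquiv, Equiv.coe_fn_mk,
    Fin.insertNth_zero']
  rw [integral_prod_symm]
  · refine integrable_of_measurable_of_abs_le ?_ (fun x => hb _)
    exact hf.comp (measurable_finCons.comp measurable_swap)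

theorem max_zero_integral_le {α : Type*} [MeasurableSpace α] {μ : Measure α} {h : α → ℝ}
    (hh : Integrable h μ) : max 0 (∫ x, h x ∂μ) ≤ ∫ x, max 0 (h x) ∂μ := by
  have hi : Integrable (fun x => max 0 (h x)) μ := (integrable_zero _ _ _).sup hh
  exact max_le (integral_nonneg fun x => le_max_left _ _)
    (integral_mono hh hi fun x => le_max_right _ _)

theorem ItemNeighbors.cons_left {Z : Type*} {n : ℕ} (z z' : Z) (y : Fin n → Z) :
    ItemNeighbors (Fin.cons z y : Fin (n + 1) → Z) (Fin.cons z' y) :=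
  ⟨0, fun j hj => by obtain ⟨k, rfl⟩ := Fin.exists_succ_eq.2 hj; simp⟩

theorem ItemNeighbors.cons_right {Z : Type*} {n : ℕ} (z : Z) {y y' : Fin n → Z}
    (h : ItemNeighbors y y') :
    ItemNeighbors (Fin.cons z y : Fin (n + 1) → Z) (Fin.cons z y') := by
  obtain ⟨i, hi⟩ := h
  refine ⟨i.succ, fun j => Fin.cases (by simp) (fun k hk => ?_) j⟩
  simpa using hi k (by simpa using hk)

theorem ItemNeighbors.symm {Z : Type*} {n : ℕ} {x x' : Fin n → Z} (h : ItemNeighbors x x') :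
    ItemNeighbors x' x :=
  h.imp fun _ hi j hj => (hi j hj).symm

/-! ### Comparison with the two-point martingale -/

/-- A bound on a convex `1`-Lipschitz function of a random variable that mostly stays within a
factor `e^{±ε}` of its mean. -/
theorem integral_convex_le_binomialStep {Z : Type*} [MeasurableSpace Z] (D : Measure Z)
    [IsProbabilityMeasure D] {ε : ℝ} (hε : 0 < ε) {f : Z → ℝ} (hf : Integrable f D)
    (hf0 : 0 ≤ ∫ z, f z ∂D) {g : ℝ → ℝ} (hgf : Integrable (fun z => g (f z)) D)
    (hg : ConvexOn ℝ Set.univ g) (hL : ∀ x y, g x - g y ≤ |x - y|) :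
    ∫ z, g (f z) ∂D ≤ binomialStep ε g (∫ z, f z ∂D) +
      2 * (∫ z, max 0 (f z - Real.exp ε * ∫ z, f z ∂D) ∂D) +
      2 * ∫ z, max 0 (Real.exp (-ε) * (∫ z, f z ∂D) - f z) ∂D := by
  set m := ∫ z, f z ∂D with hm
  obtain ⟨q, hq⟩ := exists_slope_le_binomialStep hε hf0 hg hL
  have i1 : Integrable (fun z => max 0 (f z - Real.exp ε * m)) D :=
    (integrable_zero _ _ _).sup (hf.sub (integrable_const _))
  have i2 : Integrable (fun z => max 0 (Real.exp (-ε) * m - f z)) D :=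
    (integrable_zero _ _ _).sup ((integrable_const _).sub hf)
  have i3 : Integrable (fun z => q * (f z - m)) D := (hf.sub (integrable_const _)).const_mul q
  have i4 : Integrable (fun z => binomialStep ε g m + q * (f z - m)) D :=
    (integrable_const _).add i3
  have i5 : Integrable (fun z => binomialStep ε g m + q * (f z - m) +
      2 * max 0 (f z - Real.exp ε * m)) D := i4.add (i1.const_mul 2)
  -- The linear term `q * (f z - m)` has integral zero.
  refine (integral_mono hgf (i5.add (i2.const_mul 2)) fun z => hq (f z)).trans (le_of_eq ?_)
  simp only [Pi.add_apply]
  rw [integral_add i5 (i2.const_mul 2), integral_add i4 (i1.const_mul 2),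
    integral_add (integrable_const _) i3, integral_const_mul, integral_const_mul,
    integral_const_mul, integral_sub hf (integrable_const _), ← hm]
  simp

theorem measurable_of_convexOn_univ {g : ℝ → ℝ} (hg : ConvexOn ℝ Set.univ g) : Measurable g :=
  (continuousOn_univ.1 (hg.continuousOn isOpen_univ)).measurable

theorem abs_comp_le_of_sub_le {g : ℝ → ℝ} (hL : ∀ x y, g x - g y ≤ |x - y|) {y : ℝ}
    (hy : |y| ≤ 1) : |g y| ≤ |g 0| + 1 := by
  have h1 := hL y 0
  have h2 := hL 0 y
  simp only [sub_zero, zero_sub, abs_neg] at h1 h2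
  rw [abs_le]
  constructor <;> linarith [le_abs_self (g 0), neg_abs_le (g 0)]

/-- Advanced composition in terms of convex test functions: the output probabilities of a private
algorithm on a random dataset are dominated by a binomial martingale, up to `O(n δ)`. -/
theorem sum_integral_convex_le {Z O : Type*} [MeasurableSpace Z] [Fintype O] (D : Measure Z)
    [IsProbabilityMeasure D] {ε δ : ℝ} (hε : 0 < ε) {n : ℕ} (a : (Fin n → Z) → O → ℝ)
    (ha : ∀ o, Measurable fun x => a x o) (ha0 : ∀ x o, 0 ≤ a x o) (ha1 : ∀ x o, a x o ≤ 1)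
    (hDP : ∀ x x', ItemNeighbors x x' →
      ∑ o, max 0 (a x o - Real.exp ε * a x' o) ≤ δ)
    (g : O → ℝ → ℝ) (hg : ∀ o, ConvexOn ℝ Set.univ (g o))
    (hL : ∀ o x y, g o x - g o y ≤ |x - y|) :
    ∑ o, ∫ x, g o (a x o) ∂(Measure.pi fun _ : Fin n => D) ≤
      ∑ o, (binomialStep ε)^[n] (g o) (∫ x, a x o ∂(Measure.pi fun _ : Fin n => D))
        + 4 * (n * δ) := by
  induction n generalizing g with
  | zero => simp [integral_pi_fin_zero D]
  | succ n ih =>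
    have habs (x o) : |a x o| ≤ 1 := by rw [abs_of_nonneg (ha0 x o)]; exact ha1 x o
    -- Averaging out the first item leaves an algorithm on `n` items that is again private, by
    -- Jensen's inequality for the positive part.
    set a' : (Fin n → Z) → O → ℝ := fun y o => ∫ z, a (Fin.cons z y) o ∂D with ha'
    have hsec (y : Fin n → Z) (o : O) : Measurable fun z => a (Fin.cons z y) o :=
      ((ha o).comp measurable_finCons).comp measurable_prodMk_left
    have hint (y : Fin n → Z) (o : O) : Integrable (fun z => a (Fin.cons z y) o) D :=
      integrable_of_measurable_of_abs_le (hsec y o) fun z => habs _ _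
    have ha'm (o : O) : Measurable fun y => a' y o := measurable_integral_finCons D (ha o)
    have ha'0 (y o) : 0 ≤ a' y o := integral_nonneg fun z => ha0 _ _
    have ha'1 (y o) : a' y o ≤ 1 :=
      (le_abs_self _).trans (abs_integral_le_of_abs_le fun z => habs _ _)
    have ha'abs (y o) : |a' y o| ≤ 1 := by rw [abs_of_nonneg (ha'0 y o)]; exact ha'1 y o
    have hmaxint {h : Z → ℝ} (hh : Integrable h D) : Integrable (fun z => max 0 (h z)) D :=
      (integrable_zero _ _ _).sup hh
    have key {u : Z → O → ℝ} (hu : ∀ o, Integrable (fun z => u z o) D)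
        (huv : ∀ z, ∑ o, max 0 (u z o) ≤ δ) :
        ∑ o, max 0 (∫ z, u z o ∂D) ≤ δ := by
      calc ∑ o, max 0 (∫ z, u z o ∂D) ≤ ∑ o, ∫ z, max 0 (u z o) ∂D :=
            Finset.sum_le_sum fun o _ => max_zero_integral_le (hu o)
        _ = ∫ z, ∑ o, max 0 (u z o) ∂D :=
            (integral_finsetSum _ fun o _ => hmaxint (hu o)).symm
        _ ≤ ∫ _, δ ∂D := integral_mono (integrable_finsetSum _ fun o _ => hmaxint (hu o))
            (integrable_const _) huv
        _ = δ := by simp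
    have hDP' (y y') (h : ItemNeighbors y y') :
        ∑ o, max 0 (a' y o - Real.exp ε * a' y' o) ≤ δ := by
      have := key (u := fun z o => a (Fin.cons z y) o - Real.exp ε * a (Fin.cons z y') o)
        (fun o => (hint y o).sub ((hint y' o).const_mul _))
        (fun z => hDP _ _ (h.cons_right z))
      refine le_trans (le_of_eq (Finset.sum_congr rfl fun o _ => ?_)) this
      rw [integral_sub (hint y o) ((hint y' o).const_mul _), integral_const_mul]
    have hup (y z) : ∑ o, max 0 (a (Fin.cons z y) o - Real.exp ε * a' y o) ≤ δ := by
      have := key (u := fun z' o => a (Fin.cons z y) o - Real.exp ε * a (Fin.cons z' y) o)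
        (fun o => (integrable_const _).sub ((hint y o).const_mul _))
        (fun z' => hDP _ _ (ItemNeighbors.cons_left z z' y))
      refine le_trans (le_of_eq (Finset.sum_congr rfl fun o _ => ?_)) this
      rw [integral_sub (integrable_const _) ((hint y o).const_mul _), integral_const_mul]
      simp [ha']
    have hdown (y z) : ∑ o, max 0 (Real.exp (-ε) * a' y o - a (Fin.cons z y) o) ≤ δ := by
      have := key (u := fun z' o => a (Fin.cons z' y) o - Real.exp ε * a (Fin.cons z y) o)
        (fun o => (hint y o).sub (integrable_const _))
        (fun z' => hDP _ _ (ItemNeighbors.cons_left z' z y))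
      refine le_trans (Finset.sum_le_sum fun o _ => ?_) this
      rw [integral_sub (hint y o) (integrable_const _)]
      have e : Real.exp (-ε) * a' y o - a (Fin.cons z y) o
          = Real.exp (-ε) * (a' y o - Real.exp ε * a (Fin.cons z y) o) := by
        rw [mul_sub, ← mul_assoc, ← Real.exp_add]; simp
      have e1 : Real.exp (-ε) ≤ 1 := Real.exp_le_one_iff.2 (by linarith)
      rw [e]
      simp only [integral_const, probReal_univ, one_smul]
      refine max_le (le_max_left _ _) ?_
      calc _ ≤ Real.exp (-ε) * max 0 (a' y o - Real.exp ε * a (Fin.cons z y) o) :=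
            mul_le_mul_of_nonneg_left (le_max_right _ _) (Real.exp_pos _).le
        _ ≤ _ := mul_le_of_le_one_left (le_max_left _ _) e1
    have hgm (o : O) := measurable_of_convexOn_univ (hg o)
    have hgb (x o) : |g o (a x o)| ≤ |g o 0| + 1 := abs_comp_le_of_sub_le (hL o) (habs x o)
    have hBc (o : O) := binomialStep_convexOn (ε := ε) (hg o)
    have hBL (o : O) := binomialStep_sub_le (ε := ε) (hL o)
    have hgint (y : Fin n → Z) (o : O) : Integrable (fun z => g o (a (Fin.cons z y) o)) D :=
      integrable_of_measurable_of_abs_le ((hgm o).comp (hsec y o)) fun z => hgb _ _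
    have hstep (y : Fin n → Z) : ∑ o, ∫ z, g o (a (Fin.cons z y) o) ∂D ≤
        ∑ o, binomialStep ε (g o) (a' y o) + 4 * δ := by
      have h1 : ∑ o, ∫ z, max 0 (a (Fin.cons z y) o - Real.exp ε * a' y o) ∂D ≤ δ := by
        have i (o : O) : Integrable
            (fun z => max 0 (a (Fin.cons z y) o - Real.exp ε * a' y o)) D :=
          hmaxint ((hint y o).sub (integrable_const _))
        rw [← integral_finsetSum _ fun o _ => i o]
        refine (integral_mono (integrable_finsetSum _ fun o _ => i o) (integrable_const δ)
          fun z => hup y z).trans (by simp)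
      have h2 : ∑ o, ∫ z, max 0 (Real.exp (-ε) * a' y o - a (Fin.cons z y) o) ∂D ≤ δ := by
        have i (o : O) : Integrable
            (fun z => max 0 (Real.exp (-ε) * a' y o - a (Fin.cons z y) o)) D :=
          hmaxint ((integrable_const _).sub (hint y o))
        rw [← integral_finsetSum _ fun o _ => i o]
        refine (integral_mono (integrable_finsetSum _ fun o _ => i o) (integrable_const δ)
          fun z => hdown y z).trans (by simp)
      have h3 := Finset.sum_le_sum fun o (_ : o ∈ Finset.univ) =>
        integral_convex_le_binomialStep D hε (hint y o) (ha'0 y o) (hgint y o) (hg o) (hL o)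
      rw [Finset.sum_add_distrib, Finset.sum_add_distrib, ← Finset.mul_sum,
        ← Finset.mul_sum] at h3
      linarith
    -- The step absorbed by the first item goes into the test function, which stays convex and
    -- 1-Lipschitz.
    have hIH := ih a' ha'm ha'0 ha'1 hDP' (fun o => binomialStep ε (g o)) hBc hBL
    have hmean (o : O) := integral_pi_finCons D (ha o) (fun x => habs x o)
    have hlhs (o : O) := integral_pi_finCons D ((hgm o).comp (ha o)) (fun x => hgb x o)
    have iG (o : O) : Integrable (fun y => ∫ z, g o (a (Fin.cons z y) o) ∂D)
        (Measure.pi fun _ : Fin n => D) :=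
      integrable_of_measurable_of_abs_le
        (measurable_integral_finCons D ((hgm o).comp (ha o)))
        fun y => abs_integral_le_of_abs_le fun z => hgb _ _
    have iB (o : O) : Integrable (fun y => binomialStep ε (g o) (a' y o))
        (Measure.pi fun _ : Fin n => D) :=
      integrable_of_measurable_of_abs_le ((measurable_of_convexOn_univ (hBc o)).comp (ha'm o))
        fun y => abs_comp_le_of_sub_le (hBL o) (ha'abs y o)
    have h4 : ∑ o, ∫ y, ∫ z, g o (a (Fin.cons z y) o) ∂D ∂(Measure.pi fun _ : Fin n => D) ≤
        ∑ o, ∫ y, binomialStep ε (g o) (a' y o) ∂(Measure.pi fun _ : Fin n => D) + 4 * δ := by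
      rw [← integral_finsetSum _ fun o _ => iG o, ← integral_finsetSum _ fun o _ => iB o]
      have iS := integrable_finsetSum Finset.univ fun o _ => iB o
      refine (integral_mono (integrable_finsetSum _ fun o _ => iG o)
        (iS.add (integrable_const (4 * δ))) hstep).trans (le_of_eq ?_)
      simp only [Pi.add_apply]
      rw [integral_add iS (integrable_const _)]
      simp
    simp only [Function.comp_apply] at hlhs
    simp only [hlhs, hmean, Function.iterate_succ_apply]
    push_cast
    simp only [ha'] at hIH h4
    linarith

/-! ### Concentration under bounded differences -/

/-- McDiarmid's bound on the exponential moments of a function with bounded differences. -/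
theorem integral_exp_le_of_bounded_differences {Z : Type*} [MeasurableSpace Z] (D : Measure Z)
    [IsProbabilityMeasure D] {n : ℕ} {φ : (Fin n → Z) → ℝ} (hφ : Measurable φ) {b : ℝ}
    (hb : ∀ x, |φ x| ≤ b) (hd : ∀ x x', ItemNeighbors x x' → φ x - φ x' ≤ 1) (lam : ℝ) :
    ∫ x, Real.exp (lam * φ x) ∂(Measure.pi fun _ : Fin n => D) ≤
      Real.exp (lam * ∫ x, φ x ∂(Measure.pi fun _ : Fin n => D) + n * (lam ^ 2 / 2)) := by
  induction n with
  | zero => simp [integral_pi_fin_zero D]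
  | succ n ih =>
    have hsec (y : Fin n → Z) : Measurable fun z => φ (Fin.cons z y) :=
      (hφ.comp measurable_finCons).comp measurable_prodMk_left
    have hint (y : Fin n → Z) : Integrable (fun z => φ (Fin.cons z y)) D :=
      integrable_of_measurable_of_abs_le (hsec y) fun z => hb _
    set φ' : (Fin n → Z) → ℝ := fun y => ∫ z, φ (Fin.cons z y) ∂D with hφ'
    have hφ'm : Measurable φ' := measurable_integral_finCons D hφ
    have hφ'b (y) : |φ' y| ≤ b := abs_integral_le_of_abs_le fun z => hb _
    have hφ'd (y y') (h : ItemNeighbors y y') : φ' y - φ' y' ≤ 1 := by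
      simp only [hφ']
      rw [← integral_sub (hint y) (hint y')]
      refine (integral_mono ((hint y).sub (hint y')) (integrable_const 1)
        fun z => hd _ _ (h.cons_right z)).trans (by simp)
    have hexpb {m : ℕ} {ψ : (Fin m → Z) → ℝ} (h : ∀ x, |ψ x| ≤ b) (x) :
        |Real.exp (lam * ψ x)| ≤ Real.exp (|lam| * b) := by
      rw [Real.abs_exp, Real.exp_le_exp]
      refine (le_abs_self _).trans ?_
      rw [abs_mul]
      exact mul_le_mul_of_nonneg_left (h x) (abs_nonneg _)
    have hoeff (y : Fin n → Z) : ∫ z, Real.exp (lam * φ (Fin.cons z y)) ∂D ≤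
        Real.exp (lam * φ' y) * Real.exp (lam ^ 2 / 2) := by
      obtain ⟨z₀⟩ : Nonempty Z := nonempty_of_isProbabilityMeasure D
      -- Centering at an arbitrary `z₀` gives an interval of length `2`, hence variance proxy `1` in
      -- Hoeffding's lemma.
      have hmem : ∀ᵐ z ∂D, φ (Fin.cons z y) ∈
          Set.Icc (φ (Fin.cons z₀ y) - 1) (φ (Fin.cons z₀ y) + 1) := by
        refine Filter.Eventually.of_forall fun z => ⟨?_, ?_⟩
        · linarith [hd _ _ (ItemNeighbors.cons_left z₀ z y)]
        · linarith [hd _ _ (ItemNeighbors.cons_left z z₀ y)]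
      have h1 := (hasSubgaussianMGF_of_mem_Icc (hsec y).aemeasurable hmem).mgf_le lam
      have hc : (((‖φ (Fin.cons z₀ y) + 1 - (φ (Fin.cons z₀ y) - 1)‖₊ / 2) ^ 2 : NNReal) : ℝ)
          = 1 := by
        rw [show φ (Fin.cons z₀ y) + 1 - (φ (Fin.cons z₀ y) - 1) = 2 by ring]
        push_cast
        norm_num
      rw [hc, one_mul, mgf] at h1
      have h2 : ∫ z, Real.exp (lam * φ (Fin.cons z y)) ∂D = Real.exp (lam * φ' y) *
          ∫ z, Real.exp (lam * (φ (Fin.cons z y) - φ' y)) ∂D := by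
        rw [← integral_const_mul]
        refine integral_congr_ae (Filter.Eventually.of_forall fun z => ?_)
        simp only [← Real.exp_add]
        ring_nf
      rw [h2]
      exact mul_le_mul_of_nonneg_left h1 (Real.exp_pos _).le
    have hem : Measurable fun x => Real.exp (lam * φ x) := (hφ.const_mul lam).exp
    rw [integral_pi_finCons D hφ hb, integral_pi_finCons D hem (hexpb hb)]
    have i1 : Integrable (fun y => Real.exp (lam * φ' y)) (Measure.pi fun _ : Fin n => D) :=
      integrable_of_measurable_of_abs_le (hφ'm.const_mul lam).exp (hexpb hφ'b)
    have i2 : Integrable (fun y => ∫ z, Real.exp (lam * φ (Fin.cons z y)) ∂D)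
        (Measure.pi fun _ : Fin n => D) :=
      integrable_of_measurable_of_abs_le (measurable_integral_finCons D hem)
        fun y => abs_integral_le_of_abs_le fun z => hexpb hb _
    refine (integral_mono i2 (i1.mul_const _) hoeff).trans ?_
    rw [integral_mul_const]
    refine (mul_le_mul_of_nonneg_right (ih hφ'm hφ'b hφ'd) (Real.exp_pos _).le).trans
      (le_of_eq ?_)
    rw [← Real.exp_add, hφ']
    push_cast
    ring_nf

/-- The tail is measured from a median-type level, not from the mean. Multiplying the exponential
Markov bounds at `lam` and `-lam` cancels the unknown mean. -/
theorem measureReal_le_of_bounded_differences {Z : Type*} [MeasurableSpace Z] (D : Measure Z)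
    [IsProbabilityMeasure D] {n : ℕ} (hn : 0 < n) {φ : (Fin n → Z) → ℝ} (hφ : Measurable φ)
    {b : ℝ} (hb : ∀ x, |φ x| ≤ b) (hd : ∀ x x', ItemNeighbors x x' → φ x - φ x' ≤ 1)
    (hhalf : 1 / 2 ≤ (Measure.pi fun _ : Fin n => D).real {x | φ x ≤ 0}) {κ : ℝ} (hκ : 0 ≤ κ) :
    (Measure.pi fun _ : Fin n => D).real {x | κ ≤ φ x} ≤ 2 * Real.exp (-(κ ^ 2 / (4 * n))) := by
  set μ := Measure.pi fun _ : Fin n => D with hμ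
  have hn' : (0 : ℝ) < n := by exact_mod_cast hn
  -- Minimizes the combined exponent `n * lam ^ 2 - lam * κ`.
  set lam := κ / (2 * n) with hlam
  have hlam0 : 0 ≤ lam := by positivity
  have hint (l : ℝ) : Integrable (fun x => Real.exp (l * φ x)) μ := by
    refine integrable_of_measurable_of_abs_le (b := Real.exp (|l| * b)) (hφ.const_mul l).exp
      fun x => ?_
    rw [Real.abs_exp, Real.exp_le_exp]
    refine (le_abs_self _).trans ?_
    rw [abs_mul]
    exact mul_le_mul_of_nonneg_left (hb x) (abs_nonneg _)
  have markov (l c : ℝ) := mul_meas_ge_le_integral_of_nonneg (μ := μ)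
    (Filter.Eventually.of_forall fun x => (Real.exp_pos (l * φ x)).le) (hint l) (Real.exp c)
  have h1 := markov (-lam) 0
  have h2 := markov lam (lam * κ)
  simp only [Real.exp_le_exp] at h1 h2
  have s1 : μ.real {x | φ x ≤ 0} ≤ μ.real {x | 0 ≤ -lam * φ x} :=
    measureReal_mono fun x hx => by
      simp only [Set.mem_ofPred_eq] at hx ⊢
      nlinarith
  have s2 : μ.real {x | κ ≤ φ x} ≤ μ.real {x | lam * κ ≤ lam * φ x} :=
    measureReal_mono fun x hx => mul_le_mul_of_nonneg_left hx hlam0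
  have b1 := integral_exp_le_of_bounded_differences D hφ hb hd (-lam)
  have b2 := integral_exp_le_of_bounded_differences D hφ hb hd lam
  rw [← hμ] at b1 b2
  set M := ∫ x, φ x ∂μ
  rw [Real.exp_zero, one_mul] at h1
  have c1 : 1 / 2 ≤ Real.exp (-lam * M + n * ((-lam) ^ 2 / 2)) := by linarith
  have c2 : Real.exp (lam * κ) * μ.real {x | κ ≤ φ x} ≤
      Real.exp (lam * M + n * (lam ^ 2 / 2)) :=
    (mul_le_mul_of_nonneg_left s2 (Real.exp_pos _).le).trans (h2.trans b2)
  have c3 := mul_le_mul c2 c1 (by norm_num) (Real.exp_pos _).le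
  rw [← Real.exp_add] at c3
  have e1 : lam * M + n * (lam ^ 2 / 2) + (-lam * M + n * ((-lam) ^ 2 / 2))
      = lam * κ + -(κ ^ 2 / (4 * n)) := by
    rw [hlam]; field_simp; ring
  rw [e1, Real.exp_add] at c3
  have := Real.exp_pos (lam * κ)
  have c4 : Real.exp (lam * κ) * μ.real {x | κ ≤ φ x} ≤
    Real.exp (lam * κ) * (2 * Real.exp (-(κ ^ 2 / (4 * n)))) := by linarith
  exact le_of_mul_le_mul_left c4 this

/-- Any dataset is reached from `x₀` by at most `n` single-item changes, each raising the level by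
one. -/
theorem of_forall_neighbors_succ {Z : Type*} {n : ℕ} {p : (Fin n → Z) → ℕ → Prop}
    (hp : ∀ x x' k, ItemNeighbors x x' → p x' k → p x (k + 1)) {x₀ : Fin n → Z} (h₀ : p x₀ 0)
    (x : Fin n → Z) : p x n := by
  suffices h : ∀ (s : Finset (Fin n)) (x : Fin n → Z), (∀ i ∉ s, x i = x₀ i) → p x s.card by
    simpa using h Finset.univ x (by simp)
  intro s
  induction s using Finset.induction_on with
  | empty =>
    intro x hx
    rw [show x = x₀ from funext fun i => hx i (by simp)]
    simpa using h₀
  | insert i s hi ih =>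
    intro x hx
    rw [Finset.card_insert_of_notMem hi]
    refine hp x (Function.update x i (x₀ i)) _
      ⟨i, fun j hj => by rw [Function.update_of_ne hj]⟩ (ih _ fun j hj => ?_)
    by_cases hji : j = i
    · subst hji; simp
    · rw [Function.update_of_ne hji]
      exact hx j (by simp [hji, hj])

/-- Concentration for a property that degrades by one level per changed item: if it holds at level
`0` with probability at least `1/2`, then it holds at a level below `κ` with high probability. -/
theorem measureReal_not_exists_level_le {Z : Type*} [MeasurableSpace Z] (D : Measure Z)
    [IsProbabilityMeasure D] {n : ℕ} (hn : 0 < n) {p : (Fin n → Z) → ℕ → Prop}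
    (hm : ∀ k, MeasurableSet {x | p x k})
    (hp : ∀ x x' k, ItemNeighbors x x' → p x' k → p x (k + 1))
    (hhalf : 1 / 2 ≤ (Measure.pi fun _ : Fin n => D).real {x | p x 0}) {κ : ℝ} (hκ : 0 ≤ κ) :
    (Measure.pi fun _ : Fin n => D).real {x | ¬ ∃ k ≤ n, (k : ℝ) < κ ∧ p x k} ≤
      2 * Real.exp (-(κ ^ 2 / (4 * n))) := by
  classical
  obtain ⟨x₀, h₀⟩ : ∃ x₀, p x₀ 0 := by
    by_contra! h
    have : {x | p x 0} = ∅ := Set.eq_empty_of_forall_notMem h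
    rw [this] at hhalf
    norm_num at hhalf
  have hpn := of_forall_neighbors_succ hp h₀
  have hex (x) : ∃ k, p x k := ⟨n, hpn x⟩
  -- The least level at which the property holds has bounded differences and vanishes where level
  -- `0` holds.
  have hφ : Measurable fun x => (Nat.find (hex x) : ℝ) :=
    measurable_from_top.comp (measurable_find hex hm)
  have hle (x) : Nat.find (hex x) ≤ n := Nat.find_le (hpn x)
  refine (measureReal_mono fun x hx => ?_).trans
    (measureReal_le_of_bounded_differences D hn hφ (b := n) (fun x => ?_) (fun x x' h => ?_)
      (hhalf.trans (measureReal_mono fun x hx => ?_)) hκ)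
  · by_contra hlt
    exact hx ⟨_, hle x, not_le.1 hlt, Nat.find_spec (hex x)⟩
  · rw [Nat.abs_cast]
    exact_mod_cast hle x
  · have : Nat.find (hex x) ≤ Nat.find (hex x') + 1 :=
      Nat.find_le (hp _ _ _ h (Nat.find_spec (hex x')))
    rw [sub_le_iff_le_add']
    exact_mod_cast this
  · simpa using hx

/-! ### Hockey stick divergences -/

/-- The hockey stick divergence of two families of weights. -/
noncomputable def hockeyStickSum {O : Type*} [Fintype O] (t : ℝ) (p q : O → ℝ) : ℝ :=
  ∑ o, max 0 (p o - Real.exp t * q o)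

theorem hockeyStickSum_nonneg {O : Type*} [Fintype O] (t : ℝ) (p q : O → ℝ) :
    0 ≤ hockeyStickSum t p q :=
  Finset.sum_nonneg fun _ _ => le_max_left _ _

theorem hockeyStickSum_anti {O : Type*} [Fintype O] {s t : ℝ} (hst : s ≤ t) (p : O → ℝ)
    {q : O → ℝ} (hq : ∀ o, 0 ≤ q o) : hockeyStickSum t p q ≤ hockeyStickSum s p q := by
  refine Finset.sum_le_sum fun o _ => max_le_max_left _ (sub_le_sub_left ?_ _)
  exact mul_le_mul_of_nonneg_right (Real.exp_le_exp.2 hst) (hq o)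

/-- Triangle inequality, from `p - e^{s+t} r = (p - e^s q) + e^s (q - e^t r)`. -/
theorem hockeyStickSum_add_le {O : Type*} [Fintype O] (s t : ℝ) (p q r : O → ℝ) :
    hockeyStickSum (s + t) p r ≤ hockeyStickSum s p q + Real.exp s * hockeyStickSum t q r := by
  unfold hockeyStickSum
  rw [Finset.mul_sum, ← Finset.sum_add_distrib]
  refine Finset.sum_le_sum fun o _ => ?_
  have hs := Real.exp_pos s
  have h1 := le_max_left 0 (p o - Real.exp s * q o)
  have h2 := le_max_right 0 (p o - Real.exp s * q o)
  have h3 := mul_le_mul_of_nonneg_left (le_max_left 0 (q o - Real.exp t * r o)) hs.le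
  have h4 := mul_le_mul_of_nonneg_left (le_max_right 0 (q o - Real.exp t * r o)) hs.le
  rw [mul_zero] at h3
  refine max_le (by linarith) ?_
  rw [Real.exp_add]
  linarith

theorem measurable_hockeyStickSum {α O : Type*} [MeasurableSpace α] [Fintype O] (t : ℝ)
    {p q : α → O → ℝ} (hp : ∀ o, Measurable fun x => p x o) (hq : ∀ o, Measurable fun x => q x o) :
    Measurable fun x => hockeyStickSum t (p x) (q x) :=
  Finset.measurable_fun_sum _ fun o _ =>
    measurable_const.max ((hp o).sub ((hq o).const_mul _))

/-- Differential privacy of finitely supported output probabilities, as a hockey stick bound. -/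
theorem IsItemLevelDP.hockeyStickSum_le {Z O : Type*} [MeasurableSpace Z] [Fintype O]
    [MeasurableSpace O] [MeasurableSingletonClass O] {n : ℕ} {A : Kernel (Fin n → Z) O}
    [IsMarkovKernel A] {ε δ : ℝ} (hA : IsItemLevelDP A ε δ) {x x' : Fin n → Z}
    (h : ItemNeighbors x x') :
    hockeyStickSum ε (fun o => (A x).real {o}) (fun o => (A x').real {o}) ≤ δ := by
  classical
  -- The event on which the DP inequality is tightest.
  set s := Finset.univ.filter fun o : O => 0 ≤ (A x).real {o} - Real.exp ε * (A x').real {o}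
    with hs
  have h1 := hA x x' h s
  rw [← sum_measureReal_singleton, ← sum_measureReal_singleton, Finset.mul_sum] at h1
  have h2 : hockeyStickSum ε (fun o => (A x).real {o}) (fun o => (A x').real {o}) =
      ∑ o ∈ s, ((A x).real {o} - Real.exp ε * (A x').real {o}) := by
    rw [hs, Finset.sum_filter]
    refine Finset.sum_congr rfl fun o _ => ?_
    split_ifs with ho
    · exact max_eq_right ho
    · exact max_eq_left (not_le.1 ho).le
  rw [h2, Finset.sum_sub_distrib]
  linarith

theorem convexOn_call (c : ℝ) : ConvexOn ℝ Set.univ fun m : ℝ => max 0 (m - c) := by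
  have := ((convexOn_const (0 : ℝ) convex_univ).sup
    ((convexOn_id (𝕜 := ℝ) convex_univ).add (convexOn_const (-c) convex_univ)))
  exact this

theorem convexOn_put (c : ℝ) : ConvexOn ℝ Set.univ fun m : ℝ => max 0 (c - m) := by
  have := ((convexOn_const (0 : ℝ) convex_univ).sup
    ((convexOn_const c convex_univ).sub (concaveOn_id (𝕜 := ℝ) convex_univ)))
  exact this

theorem max_zero_sub_max_zero_le (u v : ℝ) : max 0 u - max 0 v ≤ |u - v| := by
  have := abs_max_sub_max_le_abs u v 0
  rw [max_comm u, max_comm v] at this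
  exact (le_abs_self _).trans this

/-! ### Closeness to the mean output distribution -/

/-- The Chernoff exponent for `t = 3τ`, `lam = L/τ`, where `τ = ε√(nL)`. The linear part is `-3L`;
since `nε²lam² = L` and `nε² ≤ 1`, the quadratic part is at most `L + 1/4`. -/
theorem exponent_le_neg {n : ℕ} {ε L : ℝ} (hn : 0 < n) (hε : 0 < ε) (hL : 1 ≤ L)
    (hτ : ε * Real.sqrt (n * L) ≤ 1) :
    -(L / (ε * Real.sqrt (n * L)) * (3 * (ε * Real.sqrt (n * L)))) +
      n * ((L / (ε * Real.sqrt (n * L)) + 1 / 2) ^ 2 * ε ^ 2 / 2) ≤ -L := by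
  have hn' : (0 : ℝ) < n := by exact_mod_cast hn
  have hnL : 0 < n * L := by positivity
  have hτ0 : 0 < ε * Real.sqrt (n * L) := mul_pos hε (Real.sqrt_pos.2 hnL)
  have hsq : (ε * Real.sqrt (n * L)) ^ 2 = n * ε ^ 2 * L := by
    rw [mul_pow, Real.sq_sqrt hnL.le]; ring
  set τ := ε * Real.sqrt (n * L) with hτd
  set lam := L / τ with hlam
  have e1 : lam * (3 * τ) = 3 * L := by rw [hlam]; field_simp
  have e2 : n * ε ^ 2 * lam ^ 2 = L := by
    have h : lam ^ 2 * τ ^ 2 = L ^ 2 := by rw [hlam]; field_simp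
    have : (n * ε ^ 2 * lam ^ 2) * L = L * L := by rw [hsq] at h; linarith
    exact mul_right_cancel₀ (by linarith) this
  have e3 : n * ε ^ 2 ≤ 1 := by
    have : 0 < n * ε ^ 2 := by positivity
    nlinarith
  have e4 : n * ((lam + 1 / 2) ^ 2 * ε ^ 2 / 2) ≤ n * ε ^ 2 * lam ^ 2 + n * ε ^ 2 / 4 := by
    have : 0 ≤ n * ε ^ 2 * (lam - 1 / 2) ^ 2 := by positivity
    linarith
  rw [e1]
  linarith

section

variable {Z O : Type*} [MeasurableSpace Z] [Fintype O] (D : Measure Z) [IsProbabilityMeasure D]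
  {n : ℕ} {a : (Fin n → Z) → O → ℝ} {ε δ L : ℝ}

theorem integral_hockeyStickSum_mean_le (hn : 0 < n) (hε : 0 < ε) (hL : 1 ≤ L)
    (hτ : ε * Real.sqrt (n * L) ≤ 1)
    (ha : ∀ o, Measurable fun x => a x o) (ha0 : ∀ x o, 0 ≤ a x o) (ha1 : ∀ x, ∑ o, a x o = 1)
    (hDP : ∀ x x', ItemNeighbors x x' → hockeyStickSum ε (a x) (a x') ≤ δ)
    {S : O → ℝ} (hS : ∀ o, S o = ∫ x, a x o ∂(Measure.pi fun _ : Fin n => D)) :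
    ∫ x, hockeyStickSum (3 * (ε * Real.sqrt (n * L))) (a x) S
        ∂(Measure.pi fun _ : Fin n => D) ≤ Real.exp (-L) + 4 * (n * δ) ∧
    ∫ x, hockeyStickSum (3 * (ε * Real.sqrt (n * L))) S (a x)
        ∂(Measure.pi fun _ : Fin n => D) ≤
      Real.exp (3 * (ε * Real.sqrt (n * L))) * (Real.exp (-L) + 4 * (n * δ)) := by
  have hle1 (x o) : a x o ≤ 1 := by
    rw [← ha1 x]; exact Finset.single_le_sum (fun o _ => ha0 x o) (Finset.mem_univ o)
  have habs (x o) : |a x o| ≤ 1 := by rw [abs_of_nonneg (ha0 x o)]; exact hle1 x o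
  have hexp := exponent_le_neg hn hε hL hτ
  set τ := ε * Real.sqrt (n * L) with hτd
  have hτ0 : 0 ≤ τ := by positivity
  have hlam : 0 ≤ L / τ := by positivity
  have hint (o : O) : Integrable (fun x => a x o) (Measure.pi fun _ : Fin n => D) :=
    integrable_of_measurable_of_abs_le (ha o) fun x => habs x o
  have hS0 (o) : 0 ≤ S o := by rw [hS]; exact integral_nonneg fun x => ha0 x o
  have hS1 : ∑ o, S o = 1 := by
    simp_rw [hS]
    rw [← integral_finsetSum _ fun o _ => hint o]
    simp [ha1]
  have hbound : ∑ o, Real.exp (-L) * S o = Real.exp (-L) := by rw [← Finset.mul_sum, hS1, mul_one]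
  have icall (o : O) : Integrable (fun x => max 0 (a x o - Real.exp (3 * τ) * S o))
      (Measure.pi fun _ : Fin n => D) :=
    (integrable_zero _ _ _).sup ((hint o).sub (integrable_const _))
  have iput (o : O) : Integrable (fun x => max 0 (Real.exp (-(3 * τ)) * S o - a x o))
      (Measure.pi fun _ : Fin n => D) :=
    (integrable_zero _ _ _).sup ((integrable_const _).sub (hint o))
  have hexpS (o : O) : Real.exp (-(L / τ * (3 * τ)) + n * ((L / τ + 1 / 2) ^ 2 * ε ^ 2 / 2)) * S o
      ≤ Real.exp (-L) * S o :=
    mul_le_mul_of_nonneg_right (Real.exp_le_exp.2 hexp) (hS0 o)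
  constructor
  · have h := sum_integral_convex_le D hε a ha ha0 hle1 hDP
      (fun o m => max 0 (m - Real.exp (3 * τ) * S o)) (fun o => convexOn_call _)
      (fun o x y => (max_zero_sub_max_zero_le _ _).trans (le_of_eq (by congr 1; ring)))
    simp only [← hS] at h
    have h2 := Finset.sum_le_sum fun o (_ : o ∈ Finset.univ) =>
      (binomialStep_iterate_call_le (ε := ε) (t := 3 * τ) hlam (hS0 o) n).trans (hexpS o)
    unfold hockeyStickSum
    rw [integral_finsetSum _ fun o _ => icall o]
    linarith
  · have h := sum_integral_convex_le D hε a ha ha0 hle1 hDP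
      (fun o m => max 0 (Real.exp (-(3 * τ)) * S o - m)) (fun o => convexOn_put _)
      (fun o x y => (max_zero_sub_max_zero_le _ _).trans
        (le_of_eq (by rw [abs_sub_comm x y]; congr 1; ring)))
    simp only [← hS] at h
    have h2 := Finset.sum_le_sum fun o (_ : o ∈ Finset.univ) =>
      (binomialStep_iterate_put_le (ε := ε) (t := 3 * τ) (by positivity) hlam (hS0 o) n).trans
        (hexpS o)
    -- Factoring out `e^{3τ}` makes the reverse divergence a sum of functions that are 1-Lipschitz
    -- in `a x o`.
    have e (x : Fin n → Z) : hockeyStickSum (3 * τ) S (a x) =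
        Real.exp (3 * τ) * ∑ o, max 0 (Real.exp (-(3 * τ)) * S o - a x o) := by
      unfold hockeyStickSum
      rw [Finset.mul_sum]
      refine Finset.sum_congr rfl fun o _ => ?_
      rw [mul_max_of_nonneg _ _ (Real.exp_pos _).le, mul_sub, ← mul_assoc (Real.exp (3 * τ)),
        ← Real.exp_add]
      simp
    simp_rw [e]
    rw [integral_const_mul, integral_finsetSum _ fun o _ => iput o]
    refine mul_le_mul_of_nonneg_left ?_ (Real.exp_pos _).le
    linarith

theorem measureReal_not_indist_mean_le (hn : 0 < n) (hε : 0 < ε) (hL : 1 ≤ L)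
    (hτ : ε * Real.sqrt (n * L) ≤ 1 / 10) (hδ : Real.exp (-L) ≤ δ)
    (ha : ∀ o, Measurable fun x => a x o) (ha0 : ∀ x o, 0 ≤ a x o) (ha1 : ∀ x, ∑ o, a x o = 1)
    (hDP : ∀ x x', ItemNeighbors x x' → hockeyStickSum ε (a x) (a x') ≤ δ)
    {S : O → ℝ} (hS : ∀ o, S o = ∫ x, a x o ∂(Measure.pi fun _ : Fin n => D)) :
    (Measure.pi fun _ : Fin n => D).real
      {x | ¬ (hockeyStickSum (5 * (ε * Real.sqrt (n * L))) (a x) S ≤ 200 * (n * δ) ∧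
        hockeyStickSum (5 * (ε * Real.sqrt (n * L))) S (a x) ≤ 200 * (n * δ))} ≤
      2 * Real.exp (-L) := by
  obtain ⟨hE1, hE2⟩ := integral_hockeyStickSum_mean_le D hn hε hL (by linarith) ha ha0 ha1 hDP hS
  have hn1 : (1 : ℝ) ≤ n := by exact_mod_cast hn
  have hδ0 : 0 < δ := (Real.exp_pos _).trans_le hδ
  have hnδ : δ ≤ n * δ := by nlinarith
  have hnδ0 : 0 < n * δ := hδ0.trans_le hnδ
  have hτ0 : 0 ≤ ε * Real.sqrt (n * L) := by positivity
  have hS0 (o) : 0 ≤ S o := by rw [hS]; exact integral_nonneg fun x => ha0 x o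
  have hexp1 : Real.exp 1 ≤ 3 := by linarith [Real.exp_one_lt_d9]
  have hκε : ε * (2 * Real.sqrt (n * L)) = 2 * (ε * Real.sqrt (n * L)) := by ring
  set r := Real.sqrt (n * L) with hr
  set τ := ε * r with hτd
  set μ := Measure.pi fun _ : Fin n => D with hμ
  have hexp3 : Real.exp (3 * τ) ≤ 3 := (Real.exp_le_exp.2 (by linarith)).trans hexp1
  -- `40nδ` is the Markov threshold at level `0`. Each changed item multiplies by `e^ε` and adds a
  -- multiple of `δ`; the `3` bounds the `e^{3τ}` from the triangle inequality in the reverse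
  -- direction.
  set thr : ℕ → ℝ := fun k => Real.exp (k * ε) * (40 * (n * δ) + 3 * k * δ) with hthr
  set p : (Fin n → Z) → ℕ → Prop := fun x k =>
    hockeyStickSum (3 * τ + k * ε) (a x) S ≤ thr k ∧
      hockeyStickSum (3 * τ + k * ε) S (a x) ≤ thr k with hp
  have mA (t : ℝ) : Measurable fun x => hockeyStickSum t (a x) S :=
    measurable_hockeyStickSum t ha fun o => measurable_const
  have mB (t : ℝ) : Measurable fun x => hockeyStickSum t S (a x) :=
    measurable_hockeyStickSum t (fun o => measurable_const) ha
  have hpm (k : ℕ) : MeasurableSet {x | p x k} :=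
    (measurableSet_le (mA _) measurable_const).inter (measurableSet_le (mB _) measurable_const)
  have hstep (x x' : Fin n → Z) (k : ℕ) (h : ItemNeighbors x x') (hk : p x' k) :
      p x (k + 1) := by
    obtain ⟨hk1, hk2⟩ := hk
    have hEk : 1 ≤ Real.exp (k * ε) := Real.one_le_exp (by positivity)
    have hE : 1 ≤ Real.exp ε := Real.one_le_exp hε.le
    have hthr1 : thr (k + 1) = Real.exp ε * thr k + 3 * δ * (Real.exp ε * Real.exp (k * ε)) := by
      simp only [hthr]
      push_cast
      rw [show ((k : ℝ) + 1) * ε = ε + k * ε by ring, Real.exp_add]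
      ring
    have hEE : 1 ≤ Real.exp ε * Real.exp (k * ε) := one_le_mul_of_one_le_of_one_le hE hEk
    have hEE' : Real.exp (k * ε) ≤ Real.exp ε * Real.exp (k * ε) :=
      le_mul_of_one_le_left (Real.exp_pos _).le hE
    have hthr0 : 0 ≤ thr k := by positivity
    constructor
    · have h1 := hockeyStickSum_add_le ε (3 * τ + k * ε) (a x) (a x') S
      have h2 := hDP x x' h
      have h3 := mul_le_mul_of_nonneg_left hk1 (Real.exp_pos ε).le
      rw [show 3 * τ + ((k + 1 : ℕ) : ℝ) * ε = ε + (3 * τ + k * ε) by push_cast; ring, hthr1]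
      nlinarith
    · have h1 := hockeyStickSum_add_le (3 * τ + k * ε) ε S (a x') (a x)
      have h2 := mul_le_mul_of_nonneg_left (hDP x' x h.symm) (Real.exp_pos (3 * τ + k * ε)).le
      have h3 : Real.exp (3 * τ + k * ε) ≤ 3 * (Real.exp ε * Real.exp (k * ε)) := by
        rw [Real.exp_add]
        exact mul_le_mul hexp3 hEE' (Real.exp_pos _).le (by norm_num)
      have h4 := mul_le_mul_of_nonneg_right h3 hδ0.le
      have h5 : thr k ≤ Real.exp ε * thr k := le_mul_of_one_le_left hthr0 hE
      rw [show 3 * τ + ((k + 1 : ℕ) : ℝ) * ε = 3 * τ + k * ε + ε by push_cast; ring, hthr1]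
      linarith
  have hhalf : 1 / 2 ≤ μ.real {x | p x 0} := by
    set F : (Fin n → Z) → ℝ :=
      fun x => hockeyStickSum (3 * τ) (a x) S + hockeyStickSum (3 * τ) S (a x) with hF
    have hint (o : O) : Integrable (fun x => a x o) μ :=
      integrable_of_measurable_of_abs_le (b := 1) (ha o) fun x => by
        rw [abs_of_nonneg (ha0 x o), ← ha1 x]
        exact Finset.single_le_sum (fun o _ => ha0 x o) (Finset.mem_univ o)
    have iA : Integrable (fun x => hockeyStickSum (3 * τ) (a x) S) μ :=
      integrable_finsetSum _ fun o _ =>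
        (integrable_zero _ _ _).sup ((hint o).sub (integrable_const _))
    have iB : Integrable (fun x => hockeyStickSum (3 * τ) S (a x)) μ :=
      integrable_finsetSum _ fun o _ =>
        (integrable_zero _ _ _).sup ((integrable_const _).sub ((hint o).const_mul _))
    have hF0 (x) : 0 ≤ F x := add_nonneg (hockeyStickSum_nonneg _ _ _) (hockeyStickSum_nonneg _ _ _)
    have hmk := mul_meas_ge_le_integral_of_nonneg (μ := μ) (Filter.Eventually.of_forall hF0)
      (iA.add iB) (40 * (n * δ))
    -- The two directions contribute `5nδ` and `3 * 5nδ`; Markov at twice the total gives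
    -- probability `1/2`.
    have hFi : ∫ x, F x ∂μ ≤ 20 * (n * δ) := by
      rw [hF, integral_add iA iB]
      have : Real.exp (3 * τ) * (Real.exp (-L) + 4 * (n * δ)) ≤ 3 * (5 * (n * δ)) :=
        mul_le_mul hexp3 (by linarith) (by positivity) (by norm_num)
      linarith
    have hc : μ.real {x | 40 * (n * δ) ≤ F x} ≤ 1 / 2 := by
      have : 40 * (n * δ) * μ.real {x | 40 * (n * δ) ≤ F x} ≤ 40 * (n * δ) * (1 / 2) := by
        linarith
      exact le_of_mul_le_mul_left this (by positivity)
    have hms : MeasurableSet {x | 40 * (n * δ) ≤ F x} :=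
      measurableSet_le measurable_const ((mA _).add (mB _))
    have hcompl := probReal_compl_eq_one_sub (μ := μ) hms
    have hsub : μ.real {x | 40 * (n * δ) ≤ F x}ᶜ ≤ μ.real {x | p x 0} :=
      measureReal_mono fun x hx => by
        have hx' : F x < 40 * (n * δ) := not_le.1 hx
        have h1 := hockeyStickSum_nonneg (3 * τ) (a x) S
        have h2 := hockeyStickSum_nonneg (3 * τ) S (a x)
        simp only [hF] at hx'
        refine ⟨?_, ?_⟩ <;> simp only [hthr, Nat.cast_zero, zero_mul, add_zero, mul_zero,
          Real.exp_zero, one_mul] <;> linarith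
    linarith
  -- `κ = 2√(nL)` makes the McDiarmid exponent `κ²/(4n)` equal to `L`.
  have hconc := measureReal_not_exists_level_le D hn hpm hstep hhalf (κ := 2 * r) (by positivity)
  have hexpo : (2 * r) ^ 2 / (4 * n) = L := by
    rw [mul_pow, hr, Real.sq_sqrt (by positivity)]
    field_simp
    norm_num
  rw [hexpo] at hconc
  refine (measureReal_mono fun x hx => ?_).trans hconc
  rintro ⟨k, hkn, hkr, hk1, hk2⟩
  have hkε : k * ε ≤ 2 * τ := by nlinarith
  have hkn' : (k : ℝ) ≤ n := by exact_mod_cast hkn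
  -- Since `kε ≤ 2τ ≤ 1` and `k ≤ n`, the threshold is at most `3 * 43 * nδ`.
  have hthrk : thr k ≤ 200 * (n * δ) := by
    have h1 : Real.exp (k * ε) ≤ 3 := (Real.exp_le_exp.2 (by linarith)).trans hexp1
    have h2 : 40 * (n * δ) + 3 * k * δ ≤ 43 * (n * δ) := by nlinarith
    have := mul_le_mul h1 h2 (by positivity) (by norm_num)
    simp only [hthr]
    linarith
  exact hx ⟨(hockeyStickSum_anti (by linarith) _ hS0).trans (hk1.trans hthrk),
    (hockeyStickSum_anti (by linarith) _ (ha0 x)).trans (hk2.trans hthrk)⟩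

end

/-! ### The fresh output as simulator -/

theorem freshOutput_real_singleton {Z O : Type*} [MeasurableSpace Z] [MeasurableSpace O]
    [MeasurableSingletonClass O] {n : ℕ} (A : Kernel (Fin n → Z) O) [IsMarkovKernel A]
    (D : Measure Z) (o : O) :
    (freshOutput A D).real {o} = ∫ x, (A x).real {o} ∂(Measure.pi fun _ : Fin n => D) := by
  have hm : Measurable fun x => A x {o} := A.measurable_coe (measurableSet_singleton o)
  simp only [Measure.real, freshOutput]
  rw [Measure.bind_apply (measurableSet_singleton o) A.measurable.aemeasurable,
    integral_toReal hm.aemeasurable (Filter.Eventually.of_forall fun x => measure_lt_top _ _)]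

instance isProbabilityMeasure_freshOutput {Z O : Type*} [MeasurableSpace Z] [MeasurableSpace O]
    {n : ℕ} (A : Kernel (Fin n → Z) O) [IsMarkovKernel A] (D : Measure Z)
    [IsProbabilityMeasure D] : IsProbabilityMeasure (freshOutput A D) := by
  unfold freshOutput
  infer_instance

theorem isSimulatedBy_freshOutput {Z O : Type*} [MeasurableSpace Z] [Fintype O]
    [MeasurableSpace O] [MeasurableSingletonClass O] {n : ℕ} (A : Kernel (Fin n → Z) O)
    [IsMarkovKernel A] {ε δ β : ℝ} (hε : 0 < ε) (hδ : 0 < δ) (hδ' : δ ≤ 1 / 10) (hβ : 0 < β)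
    (hβ' : β ≤ 1 / 10) (hτ : ε * Real.sqrt (n * Real.log (1 / (β * δ))) ≤ 1 / 10)
    (hA : IsItemLevelDP A ε δ) (D : Measure Z) [IsProbabilityMeasure D] :
    IsSimulatedBy A β (200 * (ε * Real.sqrt (n * Real.log (1 / (β * δ))))) (200 * (n * δ))
      D (freshOutput A D) := by
  unfold IsSimulatedBy
  set μ := Measure.pi fun _ : Fin n => D with hμ
  -- With no items there is only one dataset, and its output law is exactly the fresh one.
  rcases Nat.eq_zero_or_pos n with rfl | hn
  · have h (x : Fin 0 → Z) (o : O) : (A x).real {o} = (freshOutput A D).real {o} := by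
      rw [freshOutput_real_singleton, integral_pi_fin_zero D, Subsingleton.elim x default]
    simp [Indist, hockeyStick, h]
    linarith
  have hβδ : 0 < β * δ := mul_pos hβ hδ
  have hLexp : Real.exp (-Real.log (1 / (β * δ))) = β * δ := by
    rw [one_div, Real.log_inv, neg_neg, Real.exp_log hβδ]
  have hL : 1 ≤ Real.log (1 / (β * δ)) := by
    rw [Real.le_log_iff_exp_le (by positivity), le_div_iff₀ hβδ]
    have h1 : β * δ ≤ 1 / 10 * (1 / 10) := mul_le_mul hβ' hδ' hδ.le (by norm_num)
    have h2 : Real.exp 1 ≤ 3 := by linarith [Real.exp_one_lt_d9]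
    nlinarith [Real.exp_pos 1]
  set L := Real.log (1 / (β * δ)) with hLd
  have hm (o : O) : Measurable fun x => (A x).real {o} :=
    (A.measurable_coe (measurableSet_singleton o)).ennreal_toReal
  have hsum (x) : ∑ o, (A x).real {o} = 1 := by
    rw [sum_measureReal_singleton]
    simp
  have key := measureReal_not_indist_mean_le D (a := fun x o => (A x).real {o}) hn hε hL hτ
    (by rw [hLexp]; nlinarith) hm (fun x o => measureReal_nonneg) hsum
    (fun x x' h => hA.hockeyStickSum_le h) (freshOutput_real_singleton A D)
  rw [hLexp, ← hμ] at key
  set τ := ε * Real.sqrt (n * L) with hτd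
  have hτ0 : 0 ≤ τ := by positivity
  set E := {x | Indist (200 * τ) (200 * (n * δ)) (A x) (freshOutput A D)} with hE
  have h1 : μ.real Eᶜ ≤ 2 * (β * δ) := by
    refine (measureReal_mono fun x hx => ?_).trans key
    rintro ⟨h1, h2⟩
    -- Relaxing `5τ` to `200τ` lets a single constant serve both `ε'` and `δ'`.
    exact hx ⟨(hockeyStickSum_anti (by linarith) _ fun o => measureReal_nonneg).trans h1,
      (hockeyStickSum_anti (by linarith) _ fun o => measureReal_nonneg).trans h2⟩
  have h2 := measureReal_union_le (μ := μ) E Eᶜ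
  rw [Set.union_compl_self, probReal_univ] at h2
  nlinarith

theorem theoremC2 :
    ∃ c : ℝ, 0 < c ∧ ∃ C : ℝ, 0 < C ∧
      ∀ (Z : Type*) (_ : MeasurableSpace Z)
        (O : Type*) (_ : Fintype O) (_ : MeasurableSpace O) (_ : MeasurableSingletonClass O)
        (n : ℕ) (A : Kernel (Fin n → Z) O) (_ : IsMarkovKernel A) (ε δ β : ℝ),
        0 < ε → ε ≤ c → 0 < δ → δ ≤ c → 0 < β → β ≤ c →
        ε * Real.sqrt (n * Real.log (1 / (β * δ))) ≤ c →
        IsItemLevelDP A ε δ →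
        IsPerfectlyGeneralizing A β
            (C * (ε * Real.sqrt (n * Real.log (1 / (β * δ))))) (C * (n * δ)) ∧
          ∀ D : Measure Z, IsProbabilityMeasure D →
            IsSimulatedBy A β
              (C * (ε * Real.sqrt (n * Real.log (1 / (β * δ))))) (C * (n * δ))
              D (freshOutput A D) := by
  refine ⟨1 / 10, by norm_num, 200, by norm_num, ?_⟩
  intro Z _ O _ _ _ n A _ ε δ β hε _ hδ hδ' hβ hβ' hτ hA
  have h (D : Measure Z) (_ : IsProbabilityMeasure D) :=
    isSimulatedBy_freshOutput A hε hδ hδ' hβ hβ' hτ hA D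
  exact ⟨fun D hD => ⟨freshOutput A D, inferInstance, h D hD⟩, h⟩
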